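/- Let $\{c_k\}_{k\ge1}$ denote a real sequence for which there are constants $A,B>0$ such that $$c_k\le A\,c_l\quad\text{for all } k\ge l\ge1 \qquad\text{and}\qquad \sum_{k=l}^{2l-1}|c_k-c_{k+1}|\le B\,c_l\quad\text{for all } l\ge1$$ (the second condition forces $c_l\ge0$ for all $l$). (a) For every noninteger $\alpha>0$ there is a number $c(\alpha)\in(0,1)$, depending only on $\alpha$, with $c(\alpha)=\alpha$ when $\alpha<1$, such that for every such sequence $\{c_k\}$ the condition $\sum_{k=1}^\infty c_k k^{-c(\alpha)}<\infty$ implies that both series $$\sum_{k=1}^\infty c_k\sin(k^\alpha x)\qquad\text{and}\qquad \sum_{k=1}^\infty c_k\cos(k^\alpha x)$$ converge uniformly in $x$ on $[a,b]$, for all $0<a<b$. (b) For every $\alpha\in(0,1)$ and every such sequence $\{c_k\}$, if at least one of the two series above converges at at least one real point $x\ne0$, then $c_k k^{1-\alpha}\to0$ as $k\to\infty$. -/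

import Mathlib

open Filter Topology

/-- Sequences are indexed by `k ≥ 1`: the value `c 0` is never used below.
The condition `c k ≤ A * c l` for all `k ≥ l ≥ 1`, with some constant `A > 0`. -/
def QuasiNonincreasing (c : ℕ → ℝ) : Prop :=
  ∃ A : ℝ, 0 < A ∧ ∀ l k : ℕ, 1 ≤ l → l ≤ k → c k ≤ A * c l

/-- The general monotonicity condition: the variation of `c` over `l ≤ k ≤ 2l - 1`
is at most `B * c l` for every `l ≥ 1`, with some constant `B > 0`. -/
def GeneralMonotone (c : ℕ → ℝ) : Prop :=
  ∃ B : ℝ, 0 < B ∧ ∀ l : ℕ, 1 ≤ l →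
    ∑ k ∈ Finset.Ico l (2 * l), |c k - c (k + 1)| ≤ B * c l

/-- Partial sum over `1 ≤ k ≤ N` of the series of `c k * sin (k ^ α * x)`. -/
noncomputable def sinPartialSum (c : ℕ → ℝ) (α : ℝ) (N : ℕ) (x : ℝ) : ℝ :=
  ∑ k ∈ Finset.Icc 1 N, c k * Real.sin ((k : ℝ) ^ α * x)

/-- Partial sum over `1 ≤ k ≤ N` of the series of `c k * cos (k ^ α * x)`. -/
noncomputable def cosPartialSum (c : ℕ → ℝ) (α : ℝ) (N : ℕ) (x : ℝ) : ℝ :=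
  ∑ k ∈ Finset.Icc 1 N, c k * Real.cos ((k : ℝ) ^ α * x)

/-- The functions `S N` converge, at the point `x`, to some real number. -/
def ConvergesAt (S : ℕ → ℝ → ℝ) (x : ℝ) : Prop :=
  ∃ s : ℝ, Tendsto (fun N : ℕ => S N x) atTop (𝓝 s)

/-- The functions `S N` converge, uniformly on the set `E`, to some real function. -/
def ConvergesUniformlyOn (S : ℕ → ℝ → ℝ) (E : Set ℝ) : Prop :=
  ∃ s : ℝ → ℝ, TendstoUniformlyOn S s atTop E

/-! Part (a) rests on block estimates: the sum of `exp (i k ^ α x)` over `l ≤ k < l + N`, `N ≤ l`,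
is `O(l ^ (1 - γ))` uniformly for `x` in `[a, b]`. Abel summation, with general monotonicity
bounding the variation of `c`, then makes a block of the series starting at `2p` at most a multiple
of `c (2p) * (2p) ^ (1 - γ)`, and quasi-monotonicity bounds this by the sum of `c k * k ^ (-γ)` over
`p ≤ k < 2p`. Tails of the trigonometric series are thus dominated by tails of the convergent series
(`exists_norm_sum_tail_le`).

For `α < 1` the phase increments decrease and have size `l ^ (α - 1)`, so `kusmin_landau` gives `γ =
α`. For `m < α < m + 1` it is the difference of order `m + 1` that is positive, decreasing and
small; `m` rounds of `van_der_corput` reduce to the previous situation and leave some power saving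
(`exists_norm_sum_exp_le`).

Part (b) uses that for `α < 1` the phase moves slowly: about `n ^ (1 - α)` consecutive integers near
`n` have cosine at least `1 / 2` (`exists_run_half_le_cos`). The corresponding terms are at least `c
n / (2A)`, so the Cauchy criterion forces the conclusion. -/

/-! ### The Kusmin–Landau inequality -/

open Complex in
theorem norm_exp_ofReal_I (t : ℝ) : ‖exp (t * I)‖ = 1 := norm_exp_ofReal_mul_I t

/-- The reciprocal of `exp (i t) - 1` in terms of the cotangent of `t / 2`. -/
theorem exp_sub_one_mul_cot {t : ℝ} (ht : Real.sin (t / 2) ≠ 0) :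
    (Complex.exp (t * Complex.I) - 1) *
      (-(1 / 2) - (Real.cos (t / 2) / Real.sin (t / 2) : ℝ) / 2 * Complex.I) = 1 := by
  have hs : (Real.sin (t / 2) : ℂ) ≠ 0 := by exact_mod_cast ht
  have e : Complex.exp (t * Complex.I)
      = ((Real.cos (t / 2) : ℂ) + Real.sin (t / 2) * Complex.I) ^ 2 := by
    rw [show (t : ℂ) * Complex.I = (2 : ℕ) * (((t / 2 : ℝ) : ℂ) * Complex.I) by push_cast; ring,
      Complex.exp_nat_mul, Complex.exp_mul_I, Complex.ofReal_cos, Complex.ofReal_sin]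
  have h1 : (Real.cos (t / 2) : ℂ) ^ 2 = 1 - (Real.sin (t / 2) : ℂ) ^ 2 := by
    have := Real.sin_sq_add_cos_sq (t / 2)
    rw [eq_sub_iff_add_eq, add_comm]; exact_mod_cast this
  rw [e, Complex.ofReal_div]
  set s : ℂ := (Real.sin (t / 2) : ℂ)
  set c : ℂ := (Real.cos (t / 2) : ℂ)
  have hI : Complex.I ^ 2 = -1 := Complex.I_sq
  have e2 : (c + s * Complex.I) ^ 2 - 1 = 2 * s * Complex.I * (c + s * Complex.I) := by
    linear_combination h1 - s ^ 2 * hI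
  have e3 : (-(1 / 2) - c / s / 2 * Complex.I : ℂ)
      = -(Complex.I / (2 * s)) * (c - s * Complex.I) := by
    field_simp
    linear_combination (-s) * hI
  rw [e2, e3]
  field_simp
  linear_combination (-c ^ 2 + s ^ 2 * Complex.I ^ 2 - s ^ 2) * hI + h1

theorem cot_half_le_cot_half {s t : ℝ} (hs : 0 < s) (hst : s ≤ t) (ht : t ≤ Real.pi) :
    Real.cos (t / 2) / Real.sin (t / 2) ≤ Real.cos (s / 2) / Real.sin (s / 2) := by
  have h1 : 0 < Real.sin (s / 2) :=
    Real.sin_pos_of_pos_of_lt_pi (by linarith) (by linarith [Real.pi_pos])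
  have h2 : 0 < Real.sin (t / 2) :=
    Real.sin_pos_of_pos_of_lt_pi (by linarith) (by linarith [Real.pi_pos])
  have h3 : 0 ≤ Real.sin (t / 2 - s / 2) :=
    Real.sin_nonneg_of_nonneg_of_le_pi (by linarith) (by linarith [Real.pi_pos])
  rw [Real.sin_sub] at h3
  rw [div_le_div_iff₀ h2 h1]
  linarith

theorem cot_half_le_inv {t : ℝ} (h0 : 0 < t) (ht : t ≤ Real.pi) :
    Real.cos (t / 2) / Real.sin (t / 2) ≤ 4 / t := by
  have h1 : 0 < Real.sin (t / 2) :=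
    Real.sin_pos_of_pos_of_lt_pi (by linarith) (by linarith [Real.pi_pos])
  have h2 : 2 / Real.pi * (t / 2) ≤ Real.sin (t / 2) :=
    Real.mul_le_sin (by linarith) (by linarith)
  have h3 : t / 4 ≤ Real.sin (t / 2) := by
    refine le_trans ?_ h2
    rw [div_mul_div_comm, div_le_div_iff₀ (by norm_num) (by positivity)]
    nlinarith [Real.pi_le_four]
  rw [div_le_div_iff₀ h1 h0]
  nlinarith [Real.cos_le_one (t / 2)]

/-- The Kusmin–Landau inequality for a phase with nonincreasing increments. -/
theorem kusmin_landau (f : ℕ → ℝ) (N : ℕ) (r : ℝ) (hr : 0 < r)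
    (hanti : Antitone (fwdDiff 1 f)) (hpi : fwdDiff 1 f 0 ≤ Real.pi)
    (hlow : ∀ k < N, r ≤ fwdDiff 1 f k) :
    ‖∑ k ∈ Finset.range N, Complex.exp (f k * Complex.I)‖ ≤ 10 / r := by
  rcases N with _ | N
  · simp; positivity
  -- With `w k` the reciprocal of `exp (i Δf k) - 1`, each term is `z k = (z (k + 1) - z k) * w k`,
  -- so the sum can be summed by parts.
  set g : ℕ → ℝ := fun k =>
    Real.cos (fwdDiff 1 f k / 2) / Real.sin (fwdDiff 1 f k / 2) with hg
  set w : ℕ → ℂ := fun k => -(1 / 2) - (g k : ℂ) / 2 * Complex.I with hw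
  set z : ℕ → ℂ := fun k => Complex.exp (f k * Complex.I) with hz
  have hzn : ∀ k, ‖z k‖ = 1 := fun k => norm_exp_ofReal_I _
  have hup : ∀ k, fwdDiff 1 f k ≤ Real.pi := fun k => (hanti (Nat.zero_le k)).trans hpi
  have hpos : ∀ k < N + 1, 0 < fwdDiff 1 f k := fun k hk => hr.trans_le (hlow k hk)
  have key : ∀ k < N + 1, (z (k + 1) - z k) * w k = z k := by
    intro k hk
    have hs : Real.sin (fwdDiff 1 f k / 2) ≠ 0 :=
      (Real.sin_pos_of_pos_of_lt_pi (by linarith [hpos k hk])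
        (by linarith [hup k, Real.pi_pos])).ne'
    have e : z (k + 1) = z k * Complex.exp ((fwdDiff 1 f k : ℝ) * Complex.I) := by
      simp only [hz, fwdDiff]
      rw [← Complex.exp_add]
      congr 1
      push_cast
      ring
    have := exp_sub_one_mul_cot hs
    rw [e]
    calc _ = z k * ((Complex.exp ((fwdDiff 1 f k : ℝ) * Complex.I) - 1) * w k) := by ring
      _ = z k := by rw [this, mul_one]
  have hgmono : ∀ k, k + 1 < N + 1 → g k ≤ g (k + 1) := fun k hk =>
    cot_half_le_cot_half (hpos _ hk) (hanti (Nat.le_succ k)) (hup k)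
  have hg0 : ∀ k < N + 1, 0 ≤ g k := by
    intro k hk
    apply div_nonneg
    · exact Real.cos_nonneg_of_mem_Icc ⟨by linarith [hpos k hk, Real.pi_pos], by linarith [hup k]⟩
    · exact Real.sin_nonneg_of_nonneg_of_le_pi (by linarith [hpos k hk])
        (by linarith [hup k, Real.pi_pos])
  have hgr : ∀ k < N + 1, g k ≤ 4 / r := fun k hk =>
    (cot_half_le_inv (hpos k hk) (hup k)).trans
      (div_le_div_of_nonneg_left (by norm_num) hr (hlow k hk))
  have hwn : ∀ k < N + 1, ‖w k‖ ≤ 1 / 2 + g k / 2 := by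
    intro k hk
    refine (norm_sub_le _ _).trans (le_of_eq ?_)
    rw [norm_mul, Complex.norm_I, norm_div, Complex.norm_real, Real.norm_of_nonneg (hg0 k hk)]
    norm_num
  -- The real part of `w` is constant and its imaginary part is monotone, so the total variation of
  -- `w` telescopes.
  have ind : ∀ n < N + 1, ‖∑ k ∈ Finset.range (n + 1), z k - z (n + 1) * w n‖
      ≤ ‖w 0‖ + (g n - g 0) / 2 := by
    intro n
    induction n with
    | zero =>
      intro hn
      have h := key 0 hn
      rw [Finset.sum_range_one]
      have e : z 0 - z (0 + 1) * w 0 = -(z 0 * w 0) := by linear_combination -h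
      rw [e, norm_neg, norm_mul, hzn]
      simp
    | succ n ih =>
      intro hn
      have h := key (n + 1) hn
      rw [Finset.sum_range_succ]
      have e : ∑ k ∈ Finset.range (n + 1), z k + z (n + 1) - z (n + 1 + 1) * w (n + 1)
          = (∑ k ∈ Finset.range (n + 1), z k - z (n + 1) * w n)
            + z (n + 1) * (w n - w (n + 1)) := by
        linear_combination -h
      have e2 : w n - w (n + 1) = ((g (n + 1) - g n) / 2 : ℝ) * Complex.I := by
        simp only [hw]; push_cast; ring
      have e3 : ‖z (n + 1) * (w n - w (n + 1))‖ = (g (n + 1) - g n) / 2 := by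
        rw [norm_mul, hzn, e2, norm_mul, Complex.norm_I, Complex.norm_real,
          Real.norm_of_nonneg (by linarith [hgmono n hn])]
        ring
      rw [e]
      refine (norm_add_le _ _).trans ?_
      rw [e3]
      linarith [ih (by omega)]
  have h1 := ind N (by omega)
  have h2 : ‖∑ k ∈ Finset.range (N + 1), z k‖
      ≤ ‖∑ k ∈ Finset.range (N + 1), z k - z (N + 1) * w N‖ + ‖w N‖ := by
    have := norm_add_le (∑ k ∈ Finset.range (N + 1), z k - z (N + 1) * w N) (z (N + 1) * w N)
    rwa [sub_add_cancel, norm_mul (z (N + 1)), hzn, one_mul] at this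
  -- Since `r ≤ π ≤ 4`, the constants coming from the real part of `w` are absorbed into `1 / r`.
  have h3 : 1 ≤ 4 / r := by
    rw [le_div_iff₀ hr]
    linarith [hlow 0 (by omega), hpi, Real.pi_le_four]
  have h4 : (10 : ℝ) / r = 5 / 2 * (4 / r) := by ring
  rw [h4]
  linarith [hwn 0 (by omega), hwn N (by omega), hgr N (by omega), hg0 0 (by omega)]

/-! ### The van der Corput inequality and Weyl differencing -/

theorem sum_range_shift (z : ℕ → ℂ) (N K h : ℕ) (hK : N + h ≤ K) :
    ∑ n ∈ Finset.range K, (if h ≤ n ∧ n - h < N then z (n - h) else 0)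
      = ∑ k ∈ Finset.range N, z k := by
  rw [← Finset.sum_filter]
  refine Finset.sum_nbij' (fun n => n - h) (fun k => k + h) ?_ ?_ ?_ ?_ ?_
  · intro n hn; simp at hn ⊢; omega
  · intro k hk; simp at hk ⊢; omega
  · intro n hn; simp at hn ⊢; omega
  · intro k hk; simp
  · intro n hn; rfl

/-- The van der Corput inequality, for unimodular terms with bounded correlations. -/
theorem van_der_corput (z : ℕ → ℂ) (hz : ∀ k, ‖z k‖ = 1) (N H : ℕ) (hH : 1 ≤ H) (M : ℝ)
    (hM0 : 0 ≤ M)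
    (hM : ∀ h, 1 ≤ h → h < H →
      ‖∑ k ∈ Finset.range (N - h), z (k + h) * starRingEnd ℂ (z k)‖ ≤ M) :
    ‖∑ k ∈ Finset.range N, z k‖ ^ 2 ≤ ((N : ℝ) + H) * ((N : ℝ) / H + M) := by
  classical
  -- The copies of `z` shifted by `h < H` and padded with zeros all have sum `S`. Adding them gives
  -- `H * S`, and Cauchy–Schwarz over the `N + H` positions leaves only pairwise correlations.
  set y : ℕ → ℕ → ℂ := fun h n => if h ≤ n ∧ n - h < N then z (n - h) else 0 with hy
  set S := ∑ k ∈ Finset.range N, z k with hS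
  have hsum : ∀ h < H, ∑ n ∈ Finset.range (N + H), y h n = S := fun h hh =>
    sum_range_shift z N (N + H) h (by omega)
  have corr_lt : ∀ h h', h < h' → h' < H →
      ‖∑ n ∈ Finset.range (N + H), y h n * starRingEnd ℂ (y h' n)‖ ≤ M := by
    intro h h' hlt hh'
    have e : ∑ n ∈ Finset.range (N + H), y h n * starRingEnd ℂ (y h' n)
        = ∑ k ∈ Finset.range (N - (h' - h)), z (k + (h' - h)) * starRingEnd ℂ (z k) := by
      rw [← sum_range_shift (fun k => z (k + (h' - h)) * starRingEnd ℂ (z k))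
        (N - (h' - h)) (N + H) h' (by omega)]
      refine Finset.sum_congr rfl fun n _ => ?_
      simp only [hy]
      by_cases h1 : h' ≤ n ∧ n - h' < N - (h' - h)
      · rw [if_pos h1, if_pos (by omega), if_pos (by omega)]
        congr 2
        omega
      · rw [if_neg h1]
        by_cases h2 : h ≤ n ∧ n - h < N
        · rw [if_neg (show ¬ (h' ≤ n ∧ n - h' < N) by omega)]; simp
        · rw [if_neg h2]; simp
    rw [e]
    exact hM _ (by omega) (by omega)
  have corr : ∀ h < H, ∀ h' < H,
      ‖∑ n ∈ Finset.range (N + H), y h n * starRingEnd ℂ (y h' n)‖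
        ≤ (if h = h' then (N : ℝ) else 0) + M := by
    intro h hh h' hh'
    rcases lt_trichotomy h h' with hlt | rfl | hlt
    · rw [if_neg hlt.ne, zero_add]
      exact corr_lt h h' hlt hh'
    · rw [if_pos rfl]
      have e : ∑ n ∈ Finset.range (N + H), y h n * starRingEnd ℂ (y h n) = N := by
        rw [show (N : ℂ) = ∑ k ∈ Finset.range N, (fun _ => (1 : ℂ)) k by simp,
          ← sum_range_shift (fun _ => (1 : ℂ)) N (N + H) h (by omega)]
        refine Finset.sum_congr rfl fun n _ => ?_
        simp only [hy]
        split_ifs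
        · rw [Complex.mul_conj, Complex.normSq_eq_norm_sq, hz]; simp
        · simp
      rw [e, Complex.norm_natCast]
      linarith
    · rw [if_neg hlt.ne', zero_add]
      have e : ∑ n ∈ Finset.range (N + H), y h n * starRingEnd ℂ (y h' n)
          = starRingEnd ℂ (∑ n ∈ Finset.range (N + H), y h' n * starRingEnd ℂ (y h n)) := by
        rw [map_sum]
        refine Finset.sum_congr rfl fun n _ => ?_
        rw [map_mul, Complex.conj_conj, mul_comm]
      rw [e, Complex.norm_conj]
      exact corr_lt h' h hlt hh
  set Y : ℕ → ℂ := fun n => ∑ h ∈ Finset.range H, y h n with hYdef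
  have hHS : (H : ℂ) * S = ∑ n ∈ Finset.range (N + H), Y n := by
    rw [Finset.sum_comm, Finset.sum_congr rfl fun h hh => hsum h (Finset.mem_range.1 hh)]
    simp
  have hcs : ‖(H : ℂ) * S‖ ^ 2 ≤ ((N : ℝ) + H) * ∑ n ∈ Finset.range (N + H), ‖Y n‖ ^ 2 := by
    rw [hHS]
    have h1 := norm_sum_le (Finset.range (N + H)) Y
    have h2 := sq_sum_le_card_mul_sum_sq (s := Finset.range (N + H)) (f := fun n => ‖Y n‖)
    rw [Finset.card_range] at h2
    push_cast at h2
    exact (pow_le_pow_left₀ (norm_nonneg _) h1 2).trans h2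
  have hexp : ∑ n ∈ Finset.range (N + H), ‖Y n‖ ^ 2 ≤ H * N + H * H * M := by
    have e : ((∑ n ∈ Finset.range (N + H), ‖Y n‖ ^ 2 : ℝ) : ℂ)
        = ∑ h ∈ Finset.range H, ∑ h' ∈ Finset.range H,
            ∑ n ∈ Finset.range (N + H), y h n * starRingEnd ℂ (y h' n) := by
      push_cast
      have : ∀ n, ((‖Y n‖ : ℂ)) ^ 2 = ∑ h ∈ Finset.range H, ∑ h' ∈ Finset.range H,
          y h n * starRingEnd ℂ (y h' n) := by
        intro n
        rw [← Complex.mul_conj', hYdef]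
        simp only
        rw [map_sum, Finset.sum_mul_sum]
      simp only [this]
      rw [Finset.sum_comm]
      refine Finset.sum_congr rfl fun h _ => ?_
      rw [Finset.sum_comm]
    have hn : ∑ n ∈ Finset.range (N + H), ‖Y n‖ ^ 2
        = ‖((∑ n ∈ Finset.range (N + H), ‖Y n‖ ^ 2 : ℝ) : ℂ)‖ := by
      rw [Complex.norm_real, Real.norm_of_nonneg (Finset.sum_nonneg fun _ _ => by positivity)]
    rw [hn, e]
    calc _ ≤ ∑ h ∈ Finset.range H, ∑ h' ∈ Finset.range H,
            ((if h = h' then (N : ℝ) else 0) + M) := by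
          refine norm_sum_le_of_le _ fun h hh => norm_sum_le_of_le _ fun h' hh' => ?_
          exact corr h (Finset.mem_range.1 hh) h' (Finset.mem_range.1 hh')
      _ = ∑ h ∈ Finset.range H, ((N : ℝ) + H * M) := by
          refine Finset.sum_congr rfl fun h hh => ?_
          rw [Finset.sum_add_distrib, Finset.sum_ite_eq, if_pos hh]
          simp
      _ = _ := by simp; ring
  have hHpos : (0 : ℝ) < H := by exact_mod_cast hH
  have hfin : (H : ℝ) ^ 2 * ‖S‖ ^ 2 ≤ (H : ℝ) ^ 2 * (((N : ℝ) + H) * ((N : ℝ) / H + M)) := by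
    rw [← mul_pow, ← Complex.norm_natCast, ← norm_mul]
    refine hcs.trans ((mul_le_mul_of_nonneg_left hexp (by positivity)).trans (le_of_eq ?_))
    rw [Complex.norm_natCast]
    field_simp
  exact le_of_mul_le_mul_left hfin (by positivity)

theorem sub_shift_eq_sum_fwdDiff (f : ℕ → ℝ) (h : ℕ) :
    (fun k => f (k + h) - f k) = ∑ j ∈ Finset.range h, fun k => fwdDiff 1 f (k + j) := by
  funext k
  rw [Finset.sum_apply]
  induction h with
  | zero => simp
  | succ h ih =>
    rw [Finset.sum_range_succ, ← ih, fwdDiff, ← add_assoc]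
    ring

/-- This lets a correlation phase inherit monotonicity and bounds for its differences from those of
`f` one order higher. -/
theorem fwdDiff_iter_sub_shift (f : ℕ → ℝ) (h n k : ℕ) :
    (fwdDiff 1)^[n] (fun k => f (k + h) - f k) k
      = ∑ j ∈ Finset.range h, (fwdDiff 1)^[n + 1] f (k + j) := by
  rw [sub_shift_eq_sum_fwdDiff, fwdDiff_iter_finsetSum, Finset.sum_apply]
  refine Finset.sum_congr rfl fun j _ => ?_
  rw [fwdDiff_iter_comp_add, Function.iterate_succ_apply]

/-- Weyl differencing applied `m` times before the Kusmin–Landau inequality. -/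
theorem exists_norm_sum_exp_le (m : ℕ) : ∃ C : ℝ, 1 ≤ C ∧
    ∀ (f : ℕ → ℝ) (N H : ℕ) (L r u : ℝ), (N : ℝ) ≤ L → (H : ℝ) ≤ L → 1 ≤ H → 0 < r →
      Antitone ((fwdDiff 1)^[m + 1] f) →
      (H : ℝ) ^ m * (fwdDiff 1)^[m + 1] f 0 ≤ Real.pi →
      (∀ k < N, r ≤ (fwdDiff 1)^[m + 1] f k) →
      1 / (H : ℝ) ≤ u → 1 / r ≤ L * u → u ≤ 1 →
      ‖∑ k ∈ Finset.range N, Complex.exp (f k * Complex.I)‖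
        ≤ C * L * u ^ ((1 / 2 : ℝ) ^ m) := by
  induction m with
  | zero =>
    refine ⟨10, by norm_num, fun f N H L r u hN hH h1 hr hanti hpi hlow hHu hru hu => ?_⟩
    refine (kusmin_landau f N r hr hanti (by simpa using hpi) hlow).trans ?_
    rw [pow_zero, Real.rpow_one]
    calc 10 / r = 10 * (1 / r) := by ring
      _ ≤ 10 * (L * u) := by gcongr
      _ = _ := by ring
  | succ m ih =>
    obtain ⟨C, hC, ih⟩ := ih
    refine ⟨2 * (1 + C), by linarith, fun f N H L r u hN hH h1 hr hanti hpi hlow hHu hru hu => ?_⟩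
    have hHpos : (0 : ℝ) < H := by exact_mod_cast h1
    have hL : 0 < L := hHpos.trans_le hH
    have hu0 : 0 < u := lt_of_lt_of_le (by positivity) hHu
    set v := u ^ ((1 / 2 : ℝ) ^ m) with hv
    have hv0 : 0 < v := Real.rpow_pos_of_pos hu0 _
    have huv : u ≤ v := by
      have := Real.rpow_le_rpow_of_exponent_ge hu0 hu
        (pow_le_one₀ (by norm_num) (by norm_num) : (1 / 2 : ℝ) ^ m ≤ 1)
      rwa [Real.rpow_one] at this
    -- A correlation is an exponential sum with phase `f (k + h) - f k`. Its differences are sums of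
    -- `h` differences of `f`, hence at least `r` and enlarged by at most `H`; this consumes one
    -- power of `H` in the hypothesis.
    have hcorr : ∀ h, 1 ≤ h → h < H →
        ‖∑ k ∈ Finset.range (N - h), Complex.exp (f (k + h) * Complex.I) *
          starRingEnd ℂ (Complex.exp (f k * Complex.I))‖ ≤ C * L * v := by
      intro h hh hhH
      rcases Nat.eq_zero_or_pos (N - h) with h0 | h0
      · rw [h0]; simp; positivity
      have e : ∀ k, Complex.exp (f (k + h) * Complex.I) *
          starRingEnd ℂ (Complex.exp (f k * Complex.I))
          = Complex.exp (((fun k => f (k + h) - f k) k : ℝ) * Complex.I) := by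
        intro k
        rw [← Complex.exp_conj, ← Complex.exp_add]
        congr 1
        simp
        ring
      rw [Finset.sum_congr rfl fun k _ => e k]
      refine ih (fun k => f (k + h) - f k) (N - h) H L r u ?_ hH h1 hr ?_ ?_ ?_ hHu hru hu
      · exact le_trans (by exact_mod_cast Nat.sub_le N h) hN
      · intro k l hkl
        rw [fwdDiff_iter_sub_shift, fwdDiff_iter_sub_shift]
        exact Finset.sum_le_sum fun j _ => hanti (by omega)
      · refine le_trans ?_ hpi
        have hD0 : 0 ≤ (fwdDiff 1)^[m + 1 + 1] f 0 := hr.le.trans (hlow 0 (by omega))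
        rw [pow_succ, mul_assoc]
        refine mul_le_mul_of_nonneg_left ?_ (by positivity)
        rw [fwdDiff_iter_sub_shift]
        calc _ ≤ ∑ j ∈ Finset.range h, (fwdDiff 1)^[m + 1 + 1] f 0 :=
              Finset.sum_le_sum fun j _ => hanti (by omega)
          _ = h * (fwdDiff 1)^[m + 1 + 1] f 0 := by simp
          _ ≤ _ := by gcongr
      · intro k hk
        rw [fwdDiff_iter_sub_shift]
        calc r ≤ h * r := le_mul_of_one_le_left hr.le (by exact_mod_cast hh)
          _ = ∑ j ∈ Finset.range h, r := by simp
          _ ≤ _ := Finset.sum_le_sum fun j hj =>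
              hlow _ (by have := Finset.mem_range.1 hj; omega)
    have hvdc := van_der_corput (fun k => Complex.exp (f k * Complex.I))
      (fun k => norm_exp_ofReal_I _) N H h1 (C * L * v) (by positivity) hcorr
    have hNu : (N : ℝ) / H ≤ L * v := by
      calc (N : ℝ) / H = N * (1 / H) := by ring
        _ ≤ L * v := mul_le_mul hN (hHu.trans huv) (by positivity) hL.le
    set w := u ^ ((1 / 2 : ℝ) ^ (m + 1)) with hw
    have hw0 : 0 < w := Real.rpow_pos_of_pos hu0 _
    have hwv : w ^ 2 = v := by
      rw [hw, hv, ← Real.rpow_natCast, ← Real.rpow_mul hu0.le, pow_succ]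
      congr 1
      push_cast
      ring
    refine (pow_le_pow_iff_left₀ (norm_nonneg _) (by positivity) two_ne_zero).1 ?_
    calc _ ≤ ((N : ℝ) + H) * ((N : ℝ) / H + C * L * v) := hvdc
      _ ≤ (L + L) * (L * v + C * L * v) := by gcongr
      _ = 2 * (1 + C) * (L ^ 2 * w ^ 2) := by rw [hwv]; ring
      _ ≤ (2 * (1 + C)) ^ 2 * (L ^ 2 * w ^ 2) := by
          gcongr
          nlinarith
      _ = _ := by ring

/-! ### Finite differences of the phase -/

theorem hasDerivAt_fwdDiff_iter {G G' : ℝ → ℝ} (hG : ∀ t, 0 < t → HasDerivAt G (G' t) t)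
    (n : ℕ) : ∀ t, 0 < t → HasDerivAt ((fwdDiff 1)^[n] G) ((fwdDiff 1)^[n] G' t) t := by
  induction n generalizing G G' with
  | zero => exact hG
  | succ n ih =>
    simp only [Function.iterate_succ_apply]
    refine ih fun t ht => ?_
    have h1 := (hG (t + 1) (by linarith)).comp_add_const t 1
    exact h1.sub (hG t ht)

/-- An iterated forward difference is a derivative at an intermediate point. -/
theorem exists_fwdDiff_iter_eq (G : ℕ → ℝ → ℝ)
    (hG : ∀ i t, 0 < t → HasDerivAt (G i) (G (i + 1) t) t) (n : ℕ) :
    ∀ i (t : ℝ), 0 < t → ∃ ξ, t ≤ ξ ∧ ξ ≤ t + n ∧ (fwdDiff 1)^[n] (G i) t = G (i + n) ξ := by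
  induction n with
  | zero => exact fun i t _ => ⟨t, le_rfl, by simp, rfl⟩
  | succ n ih =>
    intro i t ht
    have hd := hasDerivAt_fwdDiff_iter (hG i) n
    obtain ⟨c, ⟨hc1, hc2⟩, hc⟩ := exists_hasDerivAt_eq_slope ((fwdDiff 1)^[n] (G i))
      ((fwdDiff 1)^[n] (G (i + 1))) (show t < t + 1 by linarith)
      (fun s hs => (hd s (ht.trans_le hs.1)).continuousAt.continuousWithinAt)
      (fun s hs => hd s (ht.trans hs.1))
    obtain ⟨ξ, h1, h2, h3⟩ := ih (i + 1) c (ht.trans hc1)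
    refine ⟨ξ, by linarith, by push_cast; linarith, ?_⟩
    rw [Function.iterate_succ_apply', fwdDiff]
    rw [h3] at hc
    rw [show i + (n + 1) = i + 1 + n by ring, hc]
    simp

theorem fwdDiff_iter_comp_natCast (g : ℝ → ℝ) (l : ℕ) (n k : ℕ) :
    (fwdDiff 1)^[n] (fun k : ℕ => g ((l + k : ℕ) : ℝ)) k = (fwdDiff 1)^[n] g ((l + k : ℕ) : ℝ) := by
  induction n generalizing g with
  | zero => rfl
  | succ n ih =>
    rw [Function.iterate_succ_apply, Function.iterate_succ_apply, ← ih]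
    have : fwdDiff 1 (fun k : ℕ => g ((l + k : ℕ) : ℝ))
        = fun k : ℕ => fwdDiff 1 g ((l + k : ℕ) : ℝ) := by
      funext j
      simp [fwdDiff, add_assoc]
    rw [this]

theorem hasDerivAt_descPochhammer_rpow (α x : ℝ) (i : ℕ) (t : ℝ) (ht : 0 < t) :
    HasDerivAt (fun t : ℝ => x * (∏ j ∈ Finset.range i, (α - j)) * t ^ (α - i))
      (x * (∏ j ∈ Finset.range (i + 1), (α - j)) * t ^ (α - (i + 1 : ℕ))) t := by
  have h := (Real.hasDerivAt_rpow_const (p := α - i) (Or.inl ht.ne')).const_mul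
    (x * (∏ j ∈ Finset.range i, (α - j)))
  refine h.congr_deriv ?_
  rw [Finset.prod_range_succ, show α - ((i + 1 : ℕ) : ℝ) = α - i - 1 by push_cast; ring]
  ring

theorem fwdDiff_iter_rpow (α : ℝ) (x : ℝ) (l : ℕ) (hl : 1 ≤ l) (n k : ℕ) :
    ∃ ξ : ℝ, ((l + k : ℕ) : ℝ) ≤ ξ ∧ ξ ≤ ((l + k : ℕ) : ℝ) + n ∧
      (fwdDiff 1)^[n] (fun k : ℕ => ((l + k : ℕ) : ℝ) ^ α * x) k
        = x * (∏ j ∈ Finset.range n, (α - j)) * ξ ^ (α - n) := by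
  have hpos : (0 : ℝ) < ((l + k : ℕ) : ℝ) := by exact_mod_cast (by omega : 0 < l + k)
  obtain ⟨ξ, h1, h2, h3⟩ := exists_fwdDiff_iter_eq
    (fun i t => x * (∏ j ∈ Finset.range i, (α - j)) * t ^ (α - i))
    (hasDerivAt_descPochhammer_rpow α x) n 0 _ hpos
  refine ⟨ξ, h1, h2, ?_⟩
  rw [zero_add] at h3
  rw [← h3, ← fwdDiff_iter_comp_natCast]
  simp [mul_comm]

/-- The derivative of order `m + 1` has a positive coefficient `P`, while the next one picks up the
negative factor `α - (m + 1)`. The constant `m + 3` arises from `ξ ≤ l + k + m + 1 ≤ (m + 3) * l`.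
-/
theorem fwdDiff_iter_rpow_bounds (α : ℝ) (m : ℕ) (h1 : (m : ℝ) < α) (h2 : α < m + 1) :
    ∃ P : ℝ, 0 < P ∧ ∀ x : ℝ, 0 < x → ∀ l : ℕ, 1 ≤ l →
      Antitone ((fwdDiff 1)^[m + 1] (fun k : ℕ => ((l + k : ℕ) : ℝ) ^ α * x)) ∧
      (fwdDiff 1)^[m + 1] (fun k : ℕ => ((l + k : ℕ) : ℝ) ^ α * x) 0
        ≤ x * P * (l : ℝ) ^ (α - m - 1) ∧
      ∀ k ≤ l, x * P * ((m + 3 : ℝ) * l) ^ (α - m - 1)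
        ≤ (fwdDiff 1)^[m + 1] (fun k : ℕ => ((l + k : ℕ) : ℝ) ^ α * x) k := by
  have hP : 0 < ∏ j ∈ Finset.range (m + 1), (α - j) := by
    refine Finset.prod_pos fun j hj => ?_
    have : (j : ℝ) ≤ m := by exact_mod_cast Nat.lt_succ_iff.1 (Finset.mem_range.1 hj)
    linarith
  refine ⟨_, hP, fun x hx l hl => ⟨?_, ?_, ?_⟩⟩
  · refine antitone_nat_of_succ_le fun k => ?_
    obtain ⟨ξ, hξ, -, h⟩ := fwdDiff_iter_rpow α x l hl (m + 2) k
    have hξ0 : 0 ≤ ξ := le_trans (by positivity) hξ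
    rw [Function.iterate_succ_apply', fwdDiff, Finset.prod_range_succ] at h
    have h3 : x * ((∏ j ∈ Finset.range (m + 1), (α - j)) * (α - (m + 1 : ℕ)))
        * ξ ^ (α - (m + 2 : ℕ)) ≤ 0 := by
      refine mul_nonpos_of_nonpos_of_nonneg ?_ (Real.rpow_nonneg hξ0 _)
      refine mul_nonpos_of_nonneg_of_nonpos hx.le ?_
      refine mul_nonpos_of_nonneg_of_nonpos hP.le ?_
      push_cast; linarith
    linarith
  · obtain ⟨ξ, hξ, -, h⟩ := fwdDiff_iter_rpow α x l hl (m + 1) 0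
    have hl0 : (0 : ℝ) < l := by exact_mod_cast hl
    rw [h, show α - ((m + 1 : ℕ) : ℝ) = α - m - 1 by push_cast; ring]
    refine mul_le_mul_of_nonneg_left ?_ (by positivity)
    exact Real.rpow_le_rpow_of_nonpos hl0 (by simpa using hξ) (by linarith)
  · intro k hk
    obtain ⟨ξ, hξ, hξ2, h⟩ := fwdDiff_iter_rpow α x l hl (m + 1) k
    have hl1 : (1 : ℝ) ≤ l := by exact_mod_cast hl
    have hk1 : (k : ℝ) ≤ l := by exact_mod_cast hk
    have hk0 : (0 : ℝ) ≤ k := by positivity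
    push_cast at hξ hξ2
    rw [h, show α - ((m + 1 : ℕ) : ℝ) = α - m - 1 by push_cast; ring]
    refine mul_le_mul_of_nonneg_left ?_ (by positivity)
    refine Real.rpow_le_rpow_of_nonpos (by linarith) ?_ (by linarith)
    have : (m : ℝ) ≤ m * l := le_mul_of_one_le_right (by positivity) hl1
    linarith

/-! ### Exponential sums over blocks -/

/-- Kusmin–Landau for the phases `k ^ α * x` with `0 < α < 1`. -/
theorem norm_sum_exp_rpow_le_of_lt_one (α : ℝ) (h0 : 0 < α) (h1 : α < 1) (a b : ℝ) (ha : 0 < a) :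
    ∃ C : ℝ, 0 < C ∧ ∃ l₀ : ℕ, ∀ l : ℕ, l₀ ≤ l → ∀ N ≤ l, ∀ x ∈ Set.Icc a b,
      ‖∑ k ∈ Finset.range N, Complex.exp (((((l + k : ℕ) : ℝ) ^ α * x : ℝ) : ℂ) * Complex.I)‖
        ≤ C * (l : ℝ) ^ (1 - α) := by
  obtain ⟨P, hP, hb⟩ := fwdDiff_iter_rpow_bounds α 0 (by simpa using h0) (by simpa using h1)
  have ht : Tendsto (fun l : ℕ => b * P * (l : ℝ) ^ (α - 1)) atTop (𝓝 0) := by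
    have := ((tendsto_rpow_neg_atTop (y := 1 - α) (by linarith)).comp
      tendsto_natCast_atTop_atTop).const_mul (b * P)
    simpa using this
  obtain ⟨l₀, hl₀⟩ := eventually_atTop.1 (ht.eventually_le_const Real.pi_pos)
  refine ⟨10 / (a * P * 3 ^ (α - 1)), by positivity, l₀ + 1, fun l hl N hN x hx => ?_⟩
  have hl1 : 1 ≤ l := by omega
  have hlpos : (0 : ℝ) < l := by exact_mod_cast hl1
  have hx0 : 0 < x := ha.trans_le hx.1
  obtain ⟨hanti, hup, hlow⟩ := hb x hx0 l hl1
  have hr : 0 < x * P * ((3 : ℝ) * l) ^ (α - 1) := by positivity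
  refine (kusmin_landau (fun k : ℕ => ((l + k : ℕ) : ℝ) ^ α * x) N _ hr hanti ?_ ?_).trans ?_
  · refine hup.trans (le_trans ?_ (hl₀ l (by omega)))
    simp only [Nat.cast_zero, sub_zero]
    gcongr
    exact hx.2
  · intro k hk
    have := hlow k (by omega)
    simpa using this
  · rw [Real.mul_rpow (by norm_num) hlpos.le, show (1 - α) = -(α - 1) by ring,
      Real.rpow_neg hlpos.le, div_mul_eq_mul_div, ← div_eq_mul_inv, div_div]
    rw [show a * P * 3 ^ (α - 1) = a * (P * 3 ^ (α - 1)) by ring]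
    refine div_le_div_of_nonneg_left (by norm_num) (by positivity) ?_
    calc (l : ℝ) ^ (α - 1) * (a * (P * 3 ^ (α - 1)))
        ≤ (l : ℝ) ^ (α - 1) * (x * (P * 3 ^ (α - 1))) := by gcongr; exact hx.1
      _ = _ := by ring

/-- A power saving, by Weyl differencing, for the phases `k ^ α * x` with `m < α < m + 1`. -/
theorem exists_norm_sum_exp_rpow_le (α : ℝ) (m : ℕ) (h1 : (m : ℝ) < α) (h2 : α < m + 1) :
    ∃ γ : ℝ, 0 < γ ∧ γ < 1 ∧ ∀ a b : ℝ, 0 < a →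
    ∃ C : ℝ, 0 < C ∧ ∃ l₀ : ℕ, ∀ l : ℕ, l₀ ≤ l → ∀ N ≤ l, ∀ x ∈ Set.Icc a b,
      ‖∑ k ∈ Finset.range N, Complex.exp (((((l + k : ℕ) : ℝ) ^ α * x : ℝ) : ℂ) * Complex.I)‖
        ≤ C * (l : ℝ) ^ (1 - γ) := by
  obtain ⟨P, hP, hb⟩ := fwdDiff_iter_rpow_bounds α m h1 h2
  set s : ℝ := m + 1 - α with hs
  have hs0 : 0 < s := by linarith
  have hs1 : s < 1 := by linarith
  have hes : α - m - 1 = -s := by rw [hs]; ring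
  rw [hes] at hb
  have hm0 : (0 : ℝ) ≤ m := by positivity
  -- The shift range will be `H ≈ l ^ σ`. Since `m * σ ≤ s / 2`, the quantity `H ^ m` times the top
  -- difference is `O(l ^ (-s / 2))`, eventually below `π`.
  set σ : ℝ := s / (m + 1) / 2 with hσ
  have hσ0 : 0 < σ := by positivity
  have hσm : m * σ ≤ s / 2 := by
    have : (m + 1) * σ = s / 2 := by rw [hσ]; field_simp
    linarith
  have hσ1 : σ < 1 := by
    have : s / (m + 1) ≤ s := div_le_self hs0.le (by linarith)
    rw [hσ]; linarith
  -- The parameter `u` must dominate both `1 / H ≈ l ^ (-σ)` and `1 / (r * l) ≈ l ^ (s - 1)`.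
  set τ : ℝ := min σ (1 - s) with hτ
  have hτ0 : 0 < τ := lt_min hσ0 (by linarith)
  have hτ1 : τ < 1 := (min_le_left _ _).trans_lt hσ1
  set q : ℝ := (1 / 2 : ℝ) ^ m with hq
  have hq0 : 0 < q := by positivity
  have hq1 : q ≤ 1 := pow_le_one₀ (by norm_num) (by norm_num)
  refine ⟨τ * q, by positivity, by nlinarith, fun a b ha => ?_⟩
  obtain ⟨C, hC, hweyl⟩ := exists_norm_sum_exp_le m
  set K : ℝ := 1 / (a * P * (m + 3 : ℝ) ^ (-s)) with hK
  have hK0 : 0 < K := by positivity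
  have ht1 : Tendsto (fun l : ℕ => b * P * (l : ℝ) ^ (-(s / 2))) atTop (𝓝 0) := by
    simpa using ((tendsto_rpow_neg_atTop (y := s / 2) (by linarith)).comp
      tendsto_natCast_atTop_atTop).const_mul (b * P)
  have ht2 : Tendsto (fun l : ℕ => (2 + K) * (l : ℝ) ^ (-τ)) atTop (𝓝 0) := by
    simpa using ((tendsto_rpow_neg_atTop hτ0).comp
      tendsto_natCast_atTop_atTop).const_mul (2 + K)
  obtain ⟨l₀, hl₀⟩ := eventually_atTop.1 ((ht1.eventually_le_const Real.pi_pos).and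
    (ht2.eventually_le_const one_pos))
  refine ⟨C * (2 + K) ^ q, by positivity, l₀ + 1, fun l hl N hN x hx => ?_⟩
  obtain ⟨e1, e2⟩ := hl₀ l (by omega)
  have hl1 : 1 ≤ l := by omega
  have hl1' : (1 : ℝ) ≤ l := by exact_mod_cast hl1
  have hlpos : (0 : ℝ) < l := by linarith
  have hx0 : 0 < x := ha.trans_le hx.1
  have hb0 : 0 < b := hx0.trans_le hx.2
  obtain ⟨hanti, hup, hlow⟩ := hb x hx0 l hl1
  have hσl : 1 ≤ (l : ℝ) ^ σ := Real.one_le_rpow hl1' hσ0.le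
  set H : ℕ := ⌊(l : ℝ) ^ σ⌋₊ with hH
  have hH1 : 1 ≤ H := Nat.one_le_floor_iff _ |>.2 hσl
  have hH1' : (1 : ℝ) ≤ H := by exact_mod_cast hH1
  have hHle : (H : ℝ) ≤ (l : ℝ) ^ σ := Nat.floor_le (by positivity)
  have hHge : (l : ℝ) ^ σ ≤ 2 * H := by linarith [Nat.lt_floor_add_one ((l : ℝ) ^ σ)]
  have hr : 0 < a * P * ((m + 3 : ℝ) * l) ^ (-s) := by positivity
  have main := hweyl (fun k : ℕ => ((l + k : ℕ) : ℝ) ^ α * x) N H l _ ((2 + K) * (l : ℝ) ^ (-τ))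
    (by exact_mod_cast hN) ?_ hH1 hr hanti ?_ ?_ ?_ ?_ e2
  · refine main.trans (le_of_eq ?_)
    rw [Real.mul_rpow (by positivity) (by positivity), ← Real.rpow_mul hlpos.le,
      show 1 - τ * q = 1 + -τ * q by ring, Real.rpow_add hlpos, Real.rpow_one]
    ring
  · exact hHle.trans ((Real.rpow_le_rpow_of_exponent_le hl1' hσ1.le).trans_eq (Real.rpow_one _))
  · refine le_trans ?_ e1
    calc (H : ℝ) ^ m * _ ≤ ((l : ℝ) ^ σ) ^ m * (x * P * (l : ℝ) ^ (-s)) := by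
          refine (mul_le_mul_of_nonneg_left hup (by positivity)).trans ?_
          gcongr
      _ ≤ ((l : ℝ) ^ σ) ^ m * (b * P * (l : ℝ) ^ (-s)) := by gcongr; exact hx.2
      _ = b * P * (l : ℝ) ^ (σ * m + -s) := by
          rw [Real.rpow_add hlpos, Real.rpow_mul hlpos.le, Real.rpow_natCast]; ring
      _ ≤ _ := by
          gcongr
          · linarith
  · intro k hk
    refine le_trans ?_ (hlow k (by omega))
    gcongr
    exact hx.1
  · calc 1 / (H : ℝ) ≤ 2 / (l : ℝ) ^ σ := by
          rw [div_le_div_iff₀ (by linarith) (by linarith)]; linarith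
      _ = 2 * (l : ℝ) ^ (-σ) := by rw [Real.rpow_neg hlpos.le]; rfl
      _ ≤ (2 + K) * (l : ℝ) ^ (-τ) := by
          gcongr
          · linarith
          · exact min_le_left _ _
  · rw [Real.mul_rpow (by positivity) hlpos.le, ← mul_assoc, ← one_div_mul_one_div, ← hK]
    calc K * (1 / (l : ℝ) ^ (-s)) = l * (K * (l : ℝ) ^ (-(1 - s))) := by
          rw [show -(1 - s) = -1 + s by ring, Real.rpow_add hlpos, Real.rpow_neg hlpos.le s,
            Real.rpow_neg_one]
          field_simp
      _ ≤ l * ((2 + K) * (l : ℝ) ^ (-τ)) := by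
          gcongr
          · linarith
          · exact min_le_right _ _

/-! ### Abel summation and uniform convergence -/

theorem GeneralMonotone.nonneg {c : ℕ → ℝ} (h : GeneralMonotone c) {l : ℕ} (hl : 1 ≤ l) :
    0 ≤ c l := by
  obtain ⟨B, hB, h⟩ := h
  have := (Finset.sum_nonneg fun k _ => abs_nonneg (c k - c (k + 1))).trans (h l hl)
  exact nonneg_of_mul_nonneg_right this hB

theorem sum_range_mul_eq_abel (c : ℕ → ℝ) (z : ℕ → ℂ) (N : ℕ) :
    ∑ k ∈ Finset.range N, (c k : ℂ) * z k = c N * ∑ k ∈ Finset.range N, z k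
      + ∑ k ∈ Finset.range N, ((c k - c (k + 1) : ℝ) : ℂ) * ∑ j ∈ Finset.range (k + 1), z j := by
  induction N with
  | zero => simp
  | succ N ih =>
    rw [Finset.sum_range_succ, ih, Finset.sum_range_succ (fun k => ((c k - c (k + 1) : ℝ) : ℂ) * _),
      Finset.sum_range_succ z]
    push_cast
    ring

theorem norm_sum_mul_le_abel (c : ℕ → ℝ) (z : ℕ → ℂ) (N : ℕ) (M : ℝ)
    (hM : ∀ n ≤ N, ‖∑ k ∈ Finset.range n, z k‖ ≤ M) :
    ‖∑ k ∈ Finset.range N, (c k : ℂ) * z k‖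
      ≤ (|c N| + ∑ k ∈ Finset.range N, |c k - c (k + 1)|) * M := by
  rw [sum_range_mul_eq_abel, add_mul, Finset.sum_mul]
  refine (norm_add_le _ _).trans (add_le_add ?_ (norm_sum_le_of_le _ fun k hk => ?_))
  · rw [norm_mul, Complex.norm_real]
    exact mul_le_mul_of_nonneg_left (hM N le_rfl) (norm_nonneg _)
  · rw [norm_mul, Complex.norm_real]
    exact mul_le_mul_of_nonneg_left (hM _ (Finset.mem_range.1 hk)) (norm_nonneg _)

/-- Tails of `∑ c k * z k` are controlled by sums of `c k * k ^ (-γ)` when the sums of `z`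
over dyadic blocks have a power saving of exponent `γ`. -/
theorem exists_norm_sum_tail_le {c : ℕ → ℝ} (hq : QuasiNonincreasing c) (hg : GeneralMonotone c)
    {γ : ℝ} (hγ : 0 < γ) {C : ℝ} (hC : 0 < C) (l₀ : ℕ) :
    ∃ K : ℝ, 0 < K ∧ ∀ z : ℕ → ℂ,
      (∀ l, l₀ ≤ l → ∀ N ≤ l,
        ‖∑ k ∈ Finset.range N, z (l + k)‖ ≤ C * (l : ℝ) ^ (1 - γ)) →
      ∀ N p : ℕ, l₀ ≤ p → 1 ≤ p → ‖∑ k ∈ Finset.range N, (c (2 * p + k) : ℂ) * z (2 * p + k)‖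
        ≤ K * ∑ k ∈ Finset.Ico p (2 * p + N), c k * (k : ℝ) ^ (-γ) := by
  have hnn : ∀ k, 1 ≤ k → 0 ≤ c k := fun k => hg.nonneg
  obtain ⟨A, hA, hq⟩ := hq
  obtain ⟨B, hB, hg⟩ := hg
  refine ⟨(A + B) * C * (2 * A), by positivity, fun z hz => ?_⟩
  have hblock : ∀ p, l₀ ≤ p → 1 ≤ p → ∀ N ≤ 2 * p,
      ‖∑ k ∈ Finset.range N, (c (2 * p + k) : ℂ) * z (2 * p + k)‖
        ≤ (A + B) * C * (2 * A) * ∑ k ∈ Finset.Ico p (2 * p), c k * (k : ℝ) ^ (-γ) := by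
    intro p hp hp1 N hN
    have hppos : (0 : ℝ) < p := by exact_mod_cast hp1
    have hc0 : 0 ≤ c (2 * p) := hnn _ (by omega)
    have h1 := norm_sum_mul_le_abel (fun k => c (2 * p + k)) (fun k => z (2 * p + k)) N
      (C * ((2 * p : ℕ) : ℝ) ^ (1 - γ)) fun n hn => hz (2 * p) (by omega) n (by omega)
    have h2 : |c (2 * p + N)| ≤ A * c (2 * p) := by
      rw [abs_of_nonneg (hnn _ (by omega))]
      exact hq _ _ (by omega) (by omega)
    have h3 : ∑ k ∈ Finset.range N, |c (2 * p + k) - c (2 * p + (k + 1))| ≤ B * c (2 * p) := by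
      refine le_trans ?_ (hg (2 * p) (by omega))
      rw [Finset.sum_Ico_eq_sum_range]
      refine Finset.sum_le_sum_of_subset_of_nonneg ?_ fun _ _ _ => abs_nonneg _
      exact Finset.range_subset_range.2 (by omega)
    -- Each of the `p` indices in the preceding block satisfies `c (2p) ≤ A * c k` and `(2p) ^ (-γ)
    -- ≤ k ^ (-γ)`.
    have h4 : c (2 * p) * (p * ((2 * p : ℕ) : ℝ) ^ (-γ))
        ≤ A * ∑ k ∈ Finset.Ico p (2 * p), c k * (k : ℝ) ^ (-γ) := by
      have hcard : (p : ℝ) = ∑ k ∈ Finset.Ico p (2 * p), (1 : ℝ) := by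
        rw [Finset.sum_const, Nat.card_Ico, two_mul, Nat.add_sub_cancel]; simp
      rw [hcard, Finset.sum_mul, Finset.mul_sum, Finset.mul_sum]
      refine Finset.sum_le_sum fun k hk => ?_
      obtain ⟨hk1, hk2⟩ := Finset.mem_Ico.1 hk
      have hk0 : (0 : ℝ) < k := by exact_mod_cast (by omega : 0 < k)
      rw [one_mul, ← mul_assoc]
      refine mul_le_mul (hq k _ (by omega) hk2.le) ?_ (by positivity)
        (mul_nonneg hA.le (hnn _ (by omega)))
      exact Real.rpow_le_rpow_of_nonpos hk0 (by exact_mod_cast hk2.le) (by linarith)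
    have h5 : ((2 * p : ℕ) : ℝ) ^ (1 - γ) = 2 * (p * ((2 * p : ℕ) : ℝ) ^ (-γ)) := by
      rw [show 1 - γ = 1 + -γ by ring, Real.rpow_add (by push_cast; positivity), Real.rpow_one]
      push_cast
      ring
    calc _ ≤ _ := h1
      _ ≤ (A * c (2 * p) + B * c (2 * p)) * (C * ((2 * p : ℕ) : ℝ) ^ (1 - γ)) := by gcongr
      _ = (A + B) * C * 2 * (c (2 * p) * (p * ((2 * p : ℕ) : ℝ) ^ (-γ))) := by rw [h5]; ring
      _ ≤ (A + B) * C * 2 * (A * ∑ k ∈ Finset.Ico p (2 * p), c k * (k : ℝ) ^ (-γ)) := by gcongr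
      _ = _ := by ring
  have hmono : ∀ p q q', 1 ≤ p → q ≤ q' → ∑ k ∈ Finset.Ico p q, c k * (k : ℝ) ^ (-γ)
      ≤ ∑ k ∈ Finset.Ico p q', c k * (k : ℝ) ^ (-γ) := by
    intro p q q' hp hqq
    refine Finset.sum_le_sum_of_subset_of_nonneg (Finset.Ico_subset_Ico le_rfl hqq) ?_
    intro k hk _
    exact mul_nonneg (hnn k (by have := Finset.mem_Ico.1 hk; omega)) (by positivity)
  intro N
  -- Peel off the block `[2p, 4p)` and restart from `2p`; the majorants over `[p, 2p)` and `[2p, 2p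
  -- + N)` are adjacent, so the constant does not grow.
  induction N using Nat.strong_induction_on with
  | _ N ih =>
    intro p hp hp1
    rcases le_or_gt N (2 * p) with hN | hN
    · refine (hblock p hp hp1 N hN).trans ?_
      exact mul_le_mul_of_nonneg_left (hmono _ _ _ hp1 (by omega)) (by positivity)
    · have h1 := hblock p hp hp1 (2 * p) le_rfl
      have h2 := ih (N - 2 * p) (by omega) (2 * p) (by omega) (by omega)
      rw [← Finset.sum_range_add_sum_Ico _ hN.le, Finset.sum_Ico_eq_sum_range]
      have e : ∀ k, 2 * p + (2 * p + k) = 2 * (2 * p) + k := fun k => by ring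
      simp only [e]
      refine (norm_add_le _ _).trans ((add_le_add h1 h2).trans (le_of_eq ?_))
      rw [← mul_add, Finset.sum_Ico_consecutive _ (by omega) (by omega)]
      congr 3
      omega

theorem exists_tendstoUniformlyOn_sum {c : ℕ → ℝ} (hq : QuasiNonincreasing c)
    (hg : GeneralMonotone c) {γ : ℝ} (hγ : 0 < γ)
    (hsum : Summable fun k : ℕ => c (k + 1) * ((k + 1 : ℕ) : ℝ) ^ (-γ))
    {C : ℝ} (hC : 0 < C) (l₀ : ℕ) (z : ℕ → ℝ → ℂ) (E : Set ℝ)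
    (hz : ∀ l, l₀ ≤ l → ∀ N ≤ l, ∀ x ∈ E,
      ‖∑ k ∈ Finset.range N, z (l + k) x‖ ≤ C * (l : ℝ) ^ (1 - γ)) :
    ∃ s : ℝ → ℂ, TendstoUniformlyOn
      (fun N x => ∑ k ∈ Finset.Icc 1 N, (c k : ℂ) * z k x) s atTop E := by
  obtain ⟨K, hK, hT⟩ := exists_norm_sum_tail_le hq hg hγ hC l₀
  set F : ℕ → ℝ → ℂ := fun N x => ∑ k ∈ Finset.Icc 1 N, (c k : ℂ) * z k x with hF
  have hd : Summable fun k : ℕ => c k * (k : ℝ) ^ (-γ) :=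
    (summable_nat_add_iff 1).1 hsum
  have hcau : UniformCauchySeqOn F atTop E := by
    rw [Metric.uniformCauchySeqOn_iff]
    intro ε hε
    obtain ⟨p₀, hp₀⟩ := Metric.cauchySeq_iff.1 hd.hasSum.tendsto_sum_nat.cauchySeq
      (ε / (2 * K)) (by positivity)
    set p := p₀ + l₀ + 1 with hp
    have hhalf : ∀ n, 2 * p ≤ n → ∀ x ∈ E,
        ‖F n x - ∑ k ∈ Finset.Ico 1 (2 * p), (c k : ℂ) * z k x‖ < ε / 2 := by
      intro n hn x hx
      have e : F n x - ∑ k ∈ Finset.Ico 1 (2 * p), (c k : ℂ) * z k x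
          = ∑ k ∈ Finset.range (n + 1 - 2 * p), (c (2 * p + k) : ℂ) * z (2 * p + k) x := by
        rw [← Finset.sum_Ico_eq_sum_range (fun k => (c k : ℂ) * z k x), sub_eq_iff_eq_add', hF,
          Finset.sum_Ico_consecutive _ (by omega) (by omega)]
        rfl
      rw [e]
      refine (hT (fun k => z k x) (fun l hl N hN => hz l hl N hN x hx) _ p
        (by omega) (by omega)).trans_lt ?_
      have h1 := hp₀ (2 * p + (n + 1 - 2 * p)) (by omega) p (by omega)
      rw [Real.dist_eq, ← Finset.sum_Ico_eq_sub _ (by omega)] at h1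
      calc _ < K * (ε / (2 * K)) := mul_lt_mul_of_pos_left ((le_abs_self _).trans_lt h1) hK
        _ = ε / 2 := by field_simp
    refine ⟨2 * p, fun m hm n hn x hx => ?_⟩
    have h1 := hhalf m hm x hx
    have h2 := hhalf n hn x hx
    rw [← dist_eq_norm] at h1 h2
    linarith [dist_triangle_right (F m x) (F n x)
      (∑ k ∈ Finset.Ico 1 (2 * p), (c k : ℂ) * z k x)]
  choose! s hs using fun x (hx : x ∈ E) => cauchySeq_tendsto_of_complete (hcau.cauchySeq hx)
  exact ⟨s, hcau.tendstoUniformlyOn_of_tendsto hs⟩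

theorem convergesUniformlyOn_sin_cos {c : ℕ → ℝ} (hq : QuasiNonincreasing c)
    (hg : GeneralMonotone c) {α γ : ℝ} (hγ : 0 < γ)
    (hsum : Summable fun k : ℕ => c (k + 1) * ((k + 1 : ℕ) : ℝ) ^ (-γ))
    {C : ℝ} (hC : 0 < C) (l₀ : ℕ) (E : Set ℝ)
    (hz : ∀ l : ℕ, l₀ ≤ l → ∀ N ≤ l, ∀ x ∈ E,
      ‖∑ k ∈ Finset.range N, Complex.exp (((((l + k : ℕ) : ℝ) ^ α * x : ℝ) : ℂ) * Complex.I)‖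
        ≤ C * (l : ℝ) ^ (1 - γ)) :
    ConvergesUniformlyOn (sinPartialSum c α) E ∧ ConvergesUniformlyOn (cosPartialSum c α) E := by
  obtain ⟨s, hs⟩ := exists_tendstoUniformlyOn_sum hq hg hγ hsum hC l₀
    (fun k x => Complex.exp ((((k : ℝ) ^ α * x : ℝ) : ℂ) * Complex.I)) E hz
  constructor
  · refine ⟨fun x => (s x).im, ?_⟩
    refine (Complex.imCLM.uniformContinuous.comp_tendstoUniformlyOn hs).congr
      (.of_forall fun N x _ => ?_)
    simp only [Function.comp_apply, Complex.imCLM_apply, Complex.im_sum, Complex.im_ofReal_mul,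
      Complex.exp_ofReal_mul_I_im, sinPartialSum]
  · refine ⟨fun x => (s x).re, ?_⟩
    refine (Complex.reCLM.uniformContinuous.comp_tendstoUniformlyOn hs).congr
      (.of_forall fun N x _ => ?_)
    simp only [Function.comp_apply, Complex.reCLM_apply, Complex.re_sum, Complex.re_ofReal_mul,
      Complex.exp_ofReal_mul_I_re, cosPartialSum]

/-! ### Necessity of the decay of the coefficients -/

theorem rpow_sub_rpow_le {α u v : ℝ} (h0 : 0 < α) (h1 : α < 1) (hu : 0 < u) (huv : u ≤ v) :
    v ^ α - u ^ α ≤ u ^ (α - 1) * (v - u) := by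
  have h := rpow_one_add_le_one_add_mul_self (s := (v - u) / u) (p := α)
    (by have : 0 ≤ (v - u) / u := div_nonneg (by linarith) hu.le
        linarith) h0.le h1.le
  have e : v = u * (1 + (v - u) / u) := by field_simp; ring
  have hnn : 0 ≤ (v - u) / u := div_nonneg (by linarith) hu.le
  have e2 : v ^ α = u ^ α * (1 + (v - u) / u) ^ α := by
    conv_lhs => rw [e]
    rw [Real.mul_rpow hu.le (by linarith)]
  have hup : 0 < u ^ α := by positivity
  rw [e2, Real.rpow_sub_one hu.ne']
  calc u ^ α * (1 + (v - u) / u) ^ α - u ^ α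
      ≤ u ^ α * (1 + α * ((v - u) / u)) - u ^ α := by gcongr
    _ = u ^ α * (α * ((v - u) / u)) := by ring
    _ ≤ u ^ α * (1 * ((v - u) / u)) := by gcongr
    _ = _ := by ring

/-- Just before every large `n` there is a run of about `n ^ (1 - α)` integers `k` on which
`cos (k ^ α * x - θ)` is at least `1 / 2`. -/
theorem exists_run_half_le_cos {α x : ℝ} (h0 : 0 < α) (h1 : α < 1) (hx : 0 < x) (θ : ℝ) :
    ∃ κ : ℝ, 0 < κ ∧ ∀ᶠ n : ℕ in atTop, ∃ p q : ℕ, n ≤ 2 * p ∧ q ≤ n + 1 ∧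
      κ * (n : ℝ) ^ (1 - α) ≤ (q : ℝ) - p ∧
      ∀ k ∈ Finset.Ico p q, 1 / 2 ≤ Real.cos ((k : ℝ) ^ α * x - θ) := by
  refine ⟨1 / x * (1 / 2) ^ (1 - α), by positivity, ?_⟩
  have ht1 : Tendsto (fun n : ℕ => x * (1 - (1 / 2) ^ α) * (n : ℝ) ^ α) atTop atTop := by
    refine ((tendsto_rpow_atTop h0).comp tendsto_natCast_atTop_atTop).const_mul_atTop ?_
    have : (1 / 2 : ℝ) ^ α < 1 := Real.rpow_lt_one (by norm_num) (by norm_num) h0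
    exact mul_pos hx (by linarith)
  have ht2 : Tendsto (fun n : ℕ => 1 / x * (1 / 2) ^ (1 - α) * (n : ℝ) ^ (1 - α))
      atTop atTop :=
    ((tendsto_rpow_atTop (by linarith)).comp tendsto_natCast_atTop_atTop).const_mul_atTop
      (by positivity)
  filter_upwards [ht1.eventually_ge_atTop (2 + 2 * Real.pi), ht2.eventually_ge_atTop 1,
    eventually_ge_atTop 1] with n hn1 hn2 hn3
  have hn0 : (0 : ℝ) < n := by exact_mod_cast hn3
  have hpi := Real.pi_pos
  set Y := x * (n : ℝ) ^ α with hY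
  -- `T` is the last peak of `cos (· - θ)` for which the window `[T - 1, T + 1]` ends by the phase
  -- `Y` of `n`.
  set j : ℤ := ⌊(Y - θ - 1) / (2 * Real.pi)⌋ with hj
  set T := 2 * Real.pi * j + θ with hT
  have hT1 : T + 1 ≤ Y := by
    have := Int.floor_le ((Y - θ - 1) / (2 * Real.pi))
    rw [← hj, le_div_iff₀ (by positivity)] at this
    rw [hT]; linarith
  have hT2 : Y - 1 - 2 * Real.pi < T := by
    have := Int.lt_floor_add_one ((Y - θ - 1) / (2 * Real.pi))
    rw [← hj, div_lt_iff₀ (by positivity)] at this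
    rw [hT]; linarith
  have hhalf : x * ((n : ℝ) / 2) ^ α ≤ T - 1 := by
    have e : ((n : ℝ) / 2) ^ α = (1 / 2) ^ α * (n : ℝ) ^ α := by
      rw [← Real.mul_rpow (by norm_num) hn0.le]; congr 1; ring
    rw [e]
    have : x * (1 - (1 / 2) ^ α) * (n : ℝ) ^ α = Y - x * ((1 / 2) ^ α * (n : ℝ) ^ α) := by
      rw [hY]; ring
    linarith
  have hTpos : 0 < T - 1 := lt_of_lt_of_le (by positivity) hhalf
  have hinv : ∀ y : ℝ, 0 < y → ∃ u : ℝ, 0 < u ∧ u ^ α * x = y := by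
    intro y hy
    refine ⟨(y / x) ^ α⁻¹, by positivity, ?_⟩
    rw [Real.rpow_inv_rpow (by positivity) h0.ne']
    field_simp
  obtain ⟨u, hu0, hu⟩ := hinv (T - 1) hTpos
  obtain ⟨v, hv0, hv⟩ := hinv (T + 1) (by linarith)
  have hlt : ∀ s t : ℝ, 0 ≤ s → 0 ≤ t → s ^ α * x ≤ t ^ α * x → s ≤ t := fun s t hs ht h =>
    (Real.rpow_le_rpow_iff hs ht h0).1 (le_of_mul_le_mul_right h hx)
  have hnu : (n : ℝ) / 2 ≤ u := hlt _ _ (by positivity) hu0.le (by rw [hu]; linarith)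
  have huv : u ≤ v := hlt _ _ hu0.le hv0.le (by rw [hu, hv]; linarith)
  have hvn : v ≤ n := hlt _ _ hv0.le hn0.le (by rw [hv]; linarith)
  -- The factor 2 is a reserve: rounding the endpoints to integers loses at most 1, which is no more
  -- than half of this gap by `hn2`.
  have hgap : 2 * (1 / x * (1 / 2) ^ (1 - α) * (n : ℝ) ^ (1 - α)) ≤ v - u := by
    have e1 : 2 ≤ x * (((n : ℝ) / 2) ^ (α - 1) * (v - u)) := by
      calc (2 : ℝ) = x * (v ^ α - u ^ α) := by linarith
        _ ≤ x * (u ^ (α - 1) * (v - u)) := by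
            gcongr
            exact rpow_sub_rpow_le h0 h1 hu0 huv
        _ ≤ _ := by
            have : u ^ (α - 1) ≤ ((n : ℝ) / 2) ^ (α - 1) :=
              Real.rpow_le_rpow_of_nonpos (by positivity) hnu (by linarith)
            have h2 : 0 ≤ v - u := by linarith
            gcongr
    have e2 : (1 / 2 : ℝ) ^ (1 - α) * (n : ℝ) ^ (1 - α) = (((n : ℝ) / 2) ^ (α - 1))⁻¹ := by
      rw [← Real.mul_rpow (by norm_num) hn0.le, ← Real.rpow_neg (by positivity)]
      congr 1 <;> ring
    have hpos : 0 < ((n : ℝ) / 2) ^ (α - 1) := by positivity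
    rw [mul_assoc (1 / x), e2]
    rw [show 2 * (1 / x * (((n : ℝ) / 2) ^ (α - 1))⁻¹) = 2 / (x * ((n : ℝ) / 2) ^ (α - 1)) by
      field_simp, div_le_iff₀ (by positivity)]
    linarith
  refine ⟨⌈u⌉₊, ⌊v⌋₊ + 1, ?_, ?_, ?_, ?_⟩
  · have := Nat.le_ceil u
    have : (n : ℝ) ≤ 2 * (⌈u⌉₊ : ℝ) := by linarith
    exact_mod_cast this
  · have := Nat.floor_le hv0.le
    have : (⌊v⌋₊ : ℝ) ≤ n := by linarith
    have : ⌊v⌋₊ ≤ n := by exact_mod_cast this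
    omega
  · have h3 := Nat.ceil_lt_add_one hu0.le
    have h4 := Nat.lt_floor_add_one v
    push_cast
    linarith
  · intro k hk
    obtain ⟨hk1, hk2⟩ := Finset.mem_Ico.1 hk
    have hk1' : u ≤ k := Nat.ceil_le.1 hk1
    have hk2' : (k : ℝ) ≤ v := (Nat.le_floor_iff hv0.le).1 (by omega)
    have l1 : T - 1 ≤ (k : ℝ) ^ α * x := by
      rw [← hu]; gcongr
    have l2 : (k : ℝ) ^ α * x ≤ T + 1 := by
      rw [← hv]; gcongr
    have e : Real.cos ((k : ℝ) ^ α * x - θ) = Real.cos ((k : ℝ) ^ α * x - T) := by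
      rw [show (k : ℝ) ^ α * x - T = (k : ℝ) ^ α * x - θ - j * (2 * Real.pi) by rw [hT]; ring,
        Real.cos_sub_int_mul_two_pi]
    rw [e]
    have := Real.one_sub_sq_div_two_le_cos (x := (k : ℝ) ^ α * x - T)
    nlinarith

theorem tendsto_mul_rpow_of_tendsto_sum_cos {c : ℕ → ℝ} (hq : QuasiNonincreasing c)
    (hg : GeneralMonotone c) {α x : ℝ} (h0 : 0 < α) (h1 : α < 1) (hx : 0 < x) (θ s : ℝ)
    (hs : Tendsto (fun N : ℕ => ∑ k ∈ Finset.Icc 1 N, c k * Real.cos ((k : ℝ) ^ α * x - θ))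
      atTop (𝓝 s)) :
    Tendsto (fun k : ℕ => c k * (k : ℝ) ^ (1 - α)) atTop (𝓝 0) := by
  have hnn : ∀ k, 1 ≤ k → 0 ≤ c k := fun k => hg.nonneg
  obtain ⟨A, hA, hq⟩ := hq
  obtain ⟨κ, hκ, hrun⟩ := exists_run_half_le_cos h0 h1 hx θ
  rw [Metric.tendsto_atTop]
  intro ε hε
  obtain ⟨N₀, hN₀⟩ := Metric.cauchySeq_iff.1 hs.cauchySeq (κ * ε / (2 * A)) (by positivity)
  obtain ⟨N₁, hN₁⟩ := eventually_atTop.1 hrun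
  -- With `n ≤ 2 * p` this gives `p ≥ N₀ + 2`, so the Cauchy bound applies to the partial sums up to
  -- `p - 1` and `q - 1`.
  refine ⟨N₁ + 2 * N₀ + 4, fun n hn => ?_⟩
  obtain ⟨p, q, hp, hqn, hlen, hcos⟩ := hN₁ n (by omega)
  have hcn := hnn n (by omega)
  have hn0 : (0 : ℝ) < n := by exact_mod_cast (by omega : 0 < n)
  have hpq : p ≤ q := by
    have : 0 ≤ κ * (n : ℝ) ^ (1 - α) := by positivity
    have : (p : ℝ) ≤ q := by linarith
    exact_mod_cast this
  have hsum : ∑ k ∈ Finset.Ico p q, c k * Real.cos ((k : ℝ) ^ α * x - θ)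
      < κ * ε / (2 * A) := by
    have h := hN₀ (q - 1) (by omega) (p - 1) (by omega)
    have e : ∀ m, 1 ≤ m → Finset.Icc 1 (m - 1) = Finset.Ico 1 m := by
      intro m hm; ext k; simp; omega
    rw [Real.dist_eq, e q (by omega), e p (by omega),
      ← Finset.sum_Ico_consecutive _ (show 1 ≤ p by omega) hpq, add_sub_cancel_left] at h
    exact (le_abs_self _).trans_lt h
  have hlow : (q - p : ℝ) * (c n / (2 * A))
      ≤ ∑ k ∈ Finset.Ico p q, c k * Real.cos ((k : ℝ) ^ α * x - θ) := by
    have hcard : ∑ k ∈ Finset.Ico p q, c n / (2 * A) = (q - p : ℝ) * (c n / (2 * A)) := by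
      rw [Finset.sum_const, Nat.card_Ico, nsmul_eq_mul, Nat.cast_sub hpq]
    rw [← hcard]
    refine Finset.sum_le_sum fun k hk => ?_
    obtain ⟨hk1, hk2⟩ := Finset.mem_Ico.1 hk
    have h2 : c n ≤ A * c k := hq k n (by omega) (by omega)
    calc c n / (2 * A) ≤ c k * (1 / 2) := by
          rw [div_le_iff₀ (by positivity)]; linarith
      _ ≤ _ := mul_le_mul_of_nonneg_left (hcos k hk) (hnn k (by omega))
  have h3 : κ * (n : ℝ) ^ (1 - α) * (c n / (2 * A)) < κ * ε / (2 * A) :=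
    (mul_le_mul_of_nonneg_right hlen (by positivity)).trans_lt (hlow.trans_lt hsum)
  rw [dist_zero_right, Real.norm_of_nonneg (by positivity)]
  rw [← mul_div_assoc, div_lt_div_iff_of_pos_right (by positivity), mul_assoc] at h3
  rw [mul_comm]
  exact lt_of_mul_lt_mul_left h3 hκ.le

theorem tendsto_mul_rpow_of_convergesAt {c : ℕ → ℝ} (hq : QuasiNonincreasing c)
    (hg : GeneralMonotone c) {α x : ℝ} (h0 : 0 < α) (h1 : α < 1) (hx : 0 < x)
    (h : ConvergesAt (sinPartialSum c α) x ∨ ConvergesAt (cosPartialSum c α) x) :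
    Tendsto (fun k : ℕ => c k * (k : ℝ) ^ (1 - α)) atTop (𝓝 0) := by
  rcases h with ⟨s, hs⟩ | ⟨s, hs⟩
  · refine tendsto_mul_rpow_of_tendsto_sum_cos hq hg h0 h1 hx (Real.pi / 2) s ?_
    simpa only [sinPartialSum, Real.cos_sub_pi_div_two] using hs
  · refine tendsto_mul_rpow_of_tendsto_sum_cos hq hg h0 h1 hx 0 s ?_
    simpa only [cosPartialSum, sub_zero] using hs

/-! ### Reduction to positive `x` and conclusion -/

theorem sinPartialSum_neg (c : ℕ → ℝ) (α : ℝ) (N : ℕ) (x : ℝ) :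
    sinPartialSum c α N (-x) = -sinPartialSum c α N x := by
  simp [sinPartialSum, Finset.sum_neg_distrib]

theorem cosPartialSum_neg (c : ℕ → ℝ) (α : ℝ) (N : ℕ) (x : ℝ) :
    cosPartialSum c α N (-x) = cosPartialSum c α N x := by
  simp [cosPartialSum]

theorem theorem1p1 :
    (∀ α : ℝ, 0 < α → (∀ n : ℕ, α ≠ (n : ℝ)) →
      ∃ γ : ℝ, 0 < γ ∧ γ < 1 ∧ (α < 1 → γ = α) ∧
        ∀ c : ℕ → ℝ, QuasiNonincreasing c → GeneralMonotone c →
          Summable (fun k : ℕ => c (k + 1) * ((k + 1 : ℕ) : ℝ) ^ (-γ)) →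
          ∀ a b : ℝ, 0 < a → a < b →
            ConvergesUniformlyOn (sinPartialSum c α) (Set.Icc a b) ∧
            ConvergesUniformlyOn (cosPartialSum c α) (Set.Icc a b)) ∧
    (∀ α : ℝ, 0 < α → α < 1 →
      ∀ c : ℕ → ℝ, QuasiNonincreasing c → GeneralMonotone c →
        ∀ x : ℝ, x ≠ 0 →
          (ConvergesAt (sinPartialSum c α) x ∨ ConvergesAt (cosPartialSum c α) x) →
          Tendsto (fun k : ℕ => c k * (k : ℝ) ^ (1 - α)) atTop (𝓝 0)) := by
  refine ⟨fun α h0 hα => ?_, fun α h0 h1 c hq hg x hx h => ?_⟩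
  -- The case `α < 1` is separate because the exponent from Weyl differencing with `m = 0` need not
  -- reach `α`.
  · rcases lt_or_ge α 1 with h1 | h1
    · refine ⟨α, h0, h1, fun _ => rfl, fun c hq hg hsum a b ha _ => ?_⟩
      obtain ⟨C, hC, l₀, hz⟩ := norm_sum_exp_rpow_le_of_lt_one α h0 h1 a b ha
      exact convergesUniformlyOn_sin_cos hq hg h0 hsum hC l₀ _ hz
    · have hm : ((⌊α⌋₊ : ℕ) : ℝ) < α := lt_of_le_of_ne (Nat.floor_le h0.le) (hα _).symm
      obtain ⟨γ, hγ0, hγ1, hγ⟩ :=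
        exists_norm_sum_exp_rpow_le α ⌊α⌋₊ hm (Nat.lt_floor_add_one α)
      refine ⟨γ, hγ0, hγ1, fun h => absurd h (not_lt.2 h1), fun c hq hg hsum a b ha _ => ?_⟩
      obtain ⟨C, hC, l₀, hz⟩ := hγ a b ha
      exact convergesUniformlyOn_sin_cos hq hg hγ0 hsum hC l₀ _ hz
  · rcases lt_or_gt_of_ne hx with hx | hx
    · refine tendsto_mul_rpow_of_convergesAt hq hg h0 h1 (neg_pos.2 hx) (h.imp ?_ ?_)
      · rintro ⟨s, hs⟩
        exact ⟨-s, by simpa only [sinPartialSum_neg] using hs.neg⟩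
      · rintro ⟨s, hs⟩
        exact ⟨s, by simpa only [cosPartialSum_neg] using hs⟩
    · exact tendsto_mul_rpow_of_convergesAt hq hg h0 h1 hx h
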